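/- Let $n\in\mathbb N$, $\mathcal C=[-1,1]^n\subset\mathbb R^n$ and $I=[0,1]$. Let $S\subset\mathcal C$ be Borel measurable and countably $1$-rectifiable (a countable union of Lipschitz images of bounded subsets of $\mathbb R$), let $a\in[0,\infty]$, and let $b:S\to[0,a]$ be lower semi-continuous. Assume that $\mathcal H^1(\{z\in S: b(z)\le\lambda\})<\infty$ for all $\lambda\in[0,a)$, where $\mathcal H^1$ is the one-dimensional Hausdorff measure. Extend $b$ to $\mathcal C\setminus S$ by the value $a$, and use the convention $0\cdot\infty=0$. For $x,y\in\mathcal C$ let $\Gamma^{xy}$ be the set of Lipschitz paths $\gamma:I\to\mathcal C$ with $\gamma(0)=x$ and $\gamma(1)=y$, and let $\Gamma^{xy}_C$ be the set of those with Lipschitz constant at most $C$ (with respect to the Euclidean norm). Define the generalized urban metric $$d(x,y)=\inf_{\gamma\in\Gamma^{xy}}\left(\int_{\gamma(I)\cap S}b\,\mathrm d\mathcal H^1+a\,\mathcal H^1(\gamma(I)\setminus S)\right)\in[0,\infty]$$ and the path length $$L(\gamma)=\int_0^1 b(\gamma(t))\,|\dot\gamma(t)|\,\mathrm dt\in[0,\infty].$$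 **Proposition (Optimal path limit).** Let $((x_j,y_j))_{j\in\mathbb N}\subset\mathcal C\times\mathcal C$ be a sequence such that $d(x_j,y_j)$ is uniformly bounded, i.e. $\sup_j d(x_j,y_j)<\infty$. Let $C\ge 0$ and let $\gamma_j\in\Gamma_C^{x_jy_j}$ satisfy $L(\gamma_j)=d(x_j,y_j)$, where each $\gamma_j$ has constant speed, i.e. $|\dot\gamma_j|$ is almost everywhere equal to a constant (which may depend on $j$). Suppose that $\gamma_j\to\gamma$ uniformly on $I$ for some $\gamma\in\Gamma_C^{xy}$. Then $\gamma$ is optimal: $L(\gamma)=d(x,y)$. -/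

import Mathlib

open Set Filter Topology MeasureTheory
open scoped NNReal ENNReal

noncomputable section

namespace UrbanMetric

/-- The hypercube `[-1,1]^n` in Euclidean `n`-space. -/
def cube (n : ℕ) : Set (EuclideanSpace ℝ (Fin n)) :=
  {z | ∀ i, z i ∈ Icc (-1 : ℝ) 1}

/-- A set is countably `1`-rectifiable if it is a countable union of Lipschitz images of bounded
subsets of the real line. -/
def CountablyRectifiable {n : ℕ} (S : Set (EuclideanSpace ℝ (Fin n))) : Prop :=
  ∃ (A : ℕ → Set ℝ) (f : ℕ → ℝ → EuclideanSpace ℝ (Fin n)),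
    (∀ i, Bornology.IsBounded (A i) ∧ ∃ K : ℝ≥0, LipschitzOnWith K (f i) (A i)) ∧
      S = ⋃ i, f i '' A i

/-- The part of the network with friction coefficient at most `lam`. -/
def sublevel {n : ℕ} (S : Set (EuclideanSpace ℝ (Fin n)))
    (b : EuclideanSpace ℝ (Fin n) → ℝ≥0∞) (lam : ℝ≥0∞) : Set (EuclideanSpace ℝ (Fin n)) :=
  {z ∈ S | b z ≤ lam}

/-- A street network `S` in the cube, with lower semicontinuous friction coefficient
`b : S → [0,a]` and cost `a ∈ [0,∞]` off the network, such that for every `lam ∈ [0,a)` the part of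
the network with friction at most `lam` has finite length. Only the values of `b` on `S` matter. -/
structure IsNetwork {n : ℕ} (S : Set (EuclideanSpace ℝ (Fin n))) (a : ℝ≥0∞)
    (b : EuclideanSpace ℝ (Fin n) → ℝ≥0∞) : Prop where
  subset_cube : S ⊆ cube n
  rectifiable : CountablyRectifiable S
  measurableSet : MeasurableSet S
  lowerSemicontinuousOn : LowerSemicontinuousOn b S
  le_cost : ∀ z ∈ S, b z ≤ a
  finite_sublevel : ∀ lam < a, Measure.hausdorffMeasure 1 (sublevel S b lam) < ∞

open Classical in
/-- The friction coefficient extended by the value `a` off the network. -/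
def friction {n : ℕ} (S : Set (EuclideanSpace ℝ (Fin n))) (a : ℝ≥0∞)
    (b : EuclideanSpace ℝ (Fin n) → ℝ≥0∞) (z : EuclideanSpace ℝ (Fin n)) : ℝ≥0∞ :=
  if z ∈ S then b z else a

/-- `γ` restricted to `[0,1]` is a path in the cube from `x` to `y` with Lipschitz constant at most
`K`. Values of `γ` outside `[0,1]` play no role here or below. -/
structure IsPath {n : ℕ} (K : ℝ≥0) (x y : EuclideanSpace ℝ (Fin n))
    (γ : ℝ → EuclideanSpace ℝ (Fin n)) : Prop where
  lipschitz : LipschitzOnWith K γ (Icc 0 1)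
  mapsTo : MapsTo γ (Icc 0 1) (cube n)
  source : γ 0 = x
  target : γ 1 = y

/-- The path has constant speed: `|γ'|` is almost everywhere equal to one constant. -/
def ConstantSpeed {n : ℕ} (γ : ℝ → EuclideanSpace ℝ (Fin n)) : Prop :=
  ∃ v : ℝ, ∀ᵐ t ∂(volume.restrict (Icc (0 : ℝ) 1)), ‖derivWithin γ (Icc 0 1) t‖ = v

/-- The path length `∫ b(γ) |γ'| dt` over `[0,1]`, which counts multiplicity. -/
def length {n : ℕ} (S : Set (EuclideanSpace ℝ (Fin n))) (a : ℝ≥0∞)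
    (b : EuclideanSpace ℝ (Fin n) → ℝ≥0∞) (γ : ℝ → EuclideanSpace ℝ (Fin n)) : ℝ≥0∞ :=
  ∫⁻ t in Icc (0 : ℝ) 1, friction S a b (γ t) * ‖derivWithin γ (Icc 0 1) t‖ₑ

/-- The travel cost of a path, which only depends on its image. -/
def imageCost {n : ℕ} (S : Set (EuclideanSpace ℝ (Fin n))) (a : ℝ≥0∞)
    (b : EuclideanSpace ℝ (Fin n) → ℝ≥0∞) (γ : ℝ → EuclideanSpace ℝ (Fin n)) : ℝ≥0∞ :=
  (∫⁻ z in γ '' Icc 0 1 ∩ S, b z ∂(Measure.hausdorffMeasure 1)) +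
    a * Measure.hausdorffMeasure 1 (γ '' Icc 0 1 \ S)

/-- The generalized urban metric: the infimum of the travel costs of all Lipschitz paths in the
cube from `x` to `y`. -/
def urbanDist {n : ℕ} (S : Set (EuclideanSpace ℝ (Fin n))) (a : ℝ≥0∞)
    (b : EuclideanSpace ℝ (Fin n) → ℝ≥0∞) (x y : EuclideanSpace ℝ (Fin n)) : ℝ≥0∞ :=
  ⨅ (γ : ℝ → EuclideanSpace ℝ (Fin n)) (_ : ∃ K : ℝ≥0, IsPath K x y γ), imageCost S a b γ

end UrbanMetric

end

/-!
Length is lower semicontinuous under uniform convergence even when only the part of the curves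
outside a set of finite `μH[1]` measure is counted: the limit's image takes up as much length inside
the set as its closed thickenings do in the limit, and the approximating curves eventually run in
these thickenings. Applied to the sublevel sets of the friction coefficient, the layer cake formula
turns this into lower semicontinuity of the cost.

It remains to bound the limit of the optimal costs by `d (γ 0) (γ 1)`. If `a < ∞`, the distance `d`
is continuous. If `a = ∞` it is not, but a sequence of curves of bounded cost must eventually meet
every nontrivial arc of `γ`: otherwise it would have to travel a fixed length at arbitrarily high
friction. Thus `d (γs j u) (γ 0)` and `d (γs j v) (γ 1)` are small for some times `u` near `0` and
`v` near `1` (up to pieces of `γ` of small cost). Since subarcs of optimal curves are optimal, the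
cost of `γs j` between `u` and `v` is `d (γs j u) (γs j v)`, which is at most `d (γ 0) (γ 1)` plus a
small error.
-/

noncomputable section

namespace UrbanMetric

section Speed

variable {E : Type*} [NormedAddCommGroup E] [NormedSpace ℝ E] {γ : ℝ → E} {K : ℝ≥0}

/-- The measure `‖γ'(t)‖ dt` on the line, giving a set of times the length travelled in it. -/
def speedMeasure (γ : ℝ → E) : Measure ℝ :=
  volume.withDensity fun t ↦ ‖deriv γ t‖ₑ

instance : SFinite (speedMeasure γ) := by
  unfold speedMeasure
  infer_instance

theorem speedMeasure_absolutelyContinuous : speedMeasure γ ≪ volume :=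
  withDensity_absolutelyContinuous _ _

theorem speedMeasure_Ioc_ne_top (hγ : LipschitzWith K γ) (s t : ℝ) :
    speedMeasure γ (Ioc s t) ≠ ∞ := by
  refine ne_top_of_le_ne_top (b := ∫⁻ _ in Ioc s t, (K : ℝ≥0∞)) (by simp [ENNReal.mul_eq_top]) ?_
  rw [speedMeasure, withDensity_apply']
  refine lintegral_mono fun r ↦ ?_
  rw [enorm_eq_nnnorm, ENNReal.coe_le_coe]
  exact norm_deriv_le_of_lipschitz hγ

theorem norm_deriv_le_deriv_of_dist_le {v : ℝ → ℝ} {x : ℝ} (hv : DifferentiableAt ℝ v x)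
    (h : ∀ᶠ y in 𝓝[>] x, dist (γ x) (γ y) ≤ v y - v x) : ‖deriv γ x‖ ≤ deriv v x := by
  have hright : 𝓝[>] x ≤ 𝓝[≠] x := nhdsWithin_mono x fun y hy ↦ ne_of_gt hy
  have hvslope := (hasDerivAt_iff_tendsto_slope.1 hv.hasDerivAt).mono_left hright
  have hle : ∀ᶠ y in 𝓝[>] x, ‖slope γ x y‖ ≤ slope v x y := by
    filter_upwards [h, self_mem_nhdsWithin] with y hy hxy
    rw [slope_def_module, slope_def_module, norm_smul, smul_eq_mul, norm_inv,
      Real.norm_of_nonneg (sub_pos.2 hxy).le, ← dist_eq_norm, dist_comm]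
    exact mul_le_mul_of_nonneg_left hy (inv_nonneg.2 (sub_pos.2 hxy).le)
  by_cases hγ : DifferentiableAt ℝ γ x
  · have hγslope := (hasDerivAt_iff_tendsto_slope.1 hγ.hasDerivAt).mono_left hright
    exact le_of_tendsto_of_tendsto hγslope.norm hvslope hle
  · rw [deriv_zero_of_not_differentiableAt hγ, norm_zero]
    exact ge_of_tendsto hvslope (hle.mono fun y hy ↦ (norm_nonneg _).trans hy)

theorem speedMeasure_Icc_le_of_dist_le {v : ℝ → ℝ} {s t : ℝ} (hst : s ≤ t)
    (h : ∀ r ∈ Icc s t, ∀ r' ∈ Icc s t, r ≤ r' → dist (γ r) (γ r') ≤ v r' - v r) :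
    speedMeasure γ (Icc s t) ≤ ENNReal.ofReal (v t - v s) := by
  have hv : MonotoneOn v (uIcc s t) := by
    rw [uIcc_of_le hst]
    exact fun r hr r' hr' hrr' ↦ sub_nonneg.1 (dist_nonneg.trans (h r hr r' hr' hrr'))
  have hspeed : ∀ᵐ r ∂volume.restrict (Ioc s t), ‖deriv γ r‖ ≤ deriv v r := by
    rw [← restrict_Ioo_eq_restrict_Ioc, ae_restrict_iff' measurableSet_Ioo]
    filter_upwards [hv.ae_differentiableWithinAt_of_mem] with r hr hmem
    rw [uIcc_of_le hst] at hr
    refine norm_deriv_le_deriv_of_dist_le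
      ((hr (Ioo_subset_Icc_self hmem)).differentiableAt (Icc_mem_nhds hmem.1 hmem.2)) ?_
    filter_upwards [Ioo_mem_nhdsGT hmem.2] with r' hr'
    exact h r (Ioo_subset_Icc_self hmem) r' ⟨hmem.1.le.trans hr'.1.le, hr'.2.le⟩ hr'.1.le
  calc speedMeasure γ (Icc s t) = ∫⁻ r in Ioc s t, ‖deriv γ r‖ₑ := by
        rw [speedMeasure, withDensity_apply', setLIntegral_congr Ioc_ae_eq_Icc]
    _ ≤ ∫⁻ r in Ioc s t, ENNReal.ofReal (deriv v r) := by
        refine lintegral_mono_ae (hspeed.mono fun r hr ↦ ?_)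
        rw [← ofReal_norm]
        exact ENNReal.ofReal_le_ofReal hr
    _ = ENNReal.ofReal (∫ r in s..t, deriv v r) := by
        rw [intervalIntegral.integral_of_le hst, ofReal_integral_eq_lintegral_ofReal]
        · exact (intervalIntegrable_iff_integrableOn_Ioc_of_le hst).1 hv.intervalIntegrable_deriv
        · exact hspeed.mono fun r hr ↦ (norm_nonneg _).trans hr
    _ ≤ ENNReal.ofReal (v t - v s) := by
        have hmem := hv.intervalIntegral_deriv_mem_uIcc
        rw [uIcc_of_le (sub_nonneg.2 (hv left_mem_uIcc right_mem_uIcc hst))] at hmem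
        exact ENNReal.ofReal_le_ofReal hmem.2

theorem speedMeasure_Icc_le_of_superadditive {Φ : ℝ → ℝ → ℝ≥0∞} {s t : ℝ} (hst : s ≤ t)
    (hγΦ : ∀ r ∈ Icc s t, ∀ r' ∈ Icc s t, r ≤ r' → edist (γ r) (γ r') ≤ Φ r r')
    (hΦ : ∀ r ∈ Icc s t, ∀ r' ∈ Icc s t, r ≤ r' → Φ s r + Φ r r' ≤ Φ s r') :
    speedMeasure γ (Icc s t) ≤ Φ s t := by
  rcases eq_or_ne (Φ s t) ∞ with htop | htop
  · exact htop ▸ le_top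
  have hfin : ∀ r ∈ Icc s t, Φ s r ≠ ∞ := fun r hr ↦ ne_top_of_le_ne_top htop <|
    le_self_add.trans (hΦ r hr t (right_mem_Icc.2 hst) hr.2)
  refine (speedMeasure_Icc_le_of_dist_le (v := fun r ↦ (Φ s r).toReal) hst ?_).trans ?_
  · intro r hr r' hr' hrr'
    rw [← ENNReal.toReal_sub_of_le (le_self_add.trans (hΦ r hr r' hr' hrr')) (hfin r' hr'),
      dist_edist]
    refine ENNReal.toReal_mono (ENNReal.sub_ne_top (hfin r' hr')) ?_
    exact ENNReal.le_sub_of_add_le_left (hfin r hr) <|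
      (add_le_add_right (hγΦ r hr r' hr' hrr') _).trans (hΦ r hr r' hr' hrr')
  · exact (ENNReal.ofReal_le_ofReal (sub_le_self _ ENNReal.toReal_nonneg)).trans
      ENNReal.ofReal_toReal_le

theorem locallyIntegrable_norm_deriv [CompleteSpace E] (hγ : LipschitzWith K γ) :
    LocallyIntegrable fun t ↦ ‖deriv γ t‖ :=
  (locallyIntegrable_const (K : ℝ)).mono (stronglyMeasurable_deriv γ).norm.aestronglyMeasurable <|
    ae_of_all _ fun t ↦ by simpa using norm_deriv_le_of_lipschitz (x₀ := t) hγ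

theorem intervalIntegrable_norm_deriv [CompleteSpace E] (hγ : LipschitzWith K γ) (s t : ℝ) :
    IntervalIntegrable (fun r ↦ ‖deriv γ r‖) volume s t :=
  ((locallyIntegrable_norm_deriv hγ).integrableOn_isCompact isCompact_uIcc).intervalIntegrable

theorem norm_sub_le_integral_norm_deriv [FiniteDimensional ℝ E] (hγ : LipschitzWith K γ)
    {s t : ℝ} (hst : s ≤ t) : ‖γ t - γ s‖ ≤ ∫ r in s..t, ‖deriv γ r‖ := by
  obtain ⟨f, hf, hfnorm⟩ := exists_dual_vector'' ℝ (γ t - γ s)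
  have hfγ : LipschitzWith (‖f‖₊ * K) (f ∘ γ) := f.lipschitz.comp hγ
  have hac : AbsolutelyContinuousOnInterval (f ∘ γ) s t :=
    hfγ.lipschitzOnWith.absolutelyContinuousOnInterval
  have hderiv : ∀ᵐ r, deriv (f ∘ γ) r ≤ ‖deriv γ r‖ := by
    filter_upwards [hγ.ae_differentiableAt] with r hr
    rw [(f.hasFDerivAt.comp_hasDerivAt r hr.hasDerivAt).deriv]
    exact (le_abs_self _).trans (f.le_of_opNorm_le hf _ |>.trans_eq (one_mul _))
  calc ‖γ t - γ s‖ = (f ∘ γ) t - (f ∘ γ) s := by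
        rw [Function.comp_apply, Function.comp_apply, ← map_sub]; exact hfnorm.symm
    _ = ∫ r in s..t, deriv (f ∘ γ) r := hac.integral_deriv_eq_sub.symm
    _ ≤ ∫ r in s..t, ‖deriv γ r‖ :=
        intervalIntegral.integral_mono_ae hst hac.intervalIntegrable_deriv
          (intervalIntegrable_norm_deriv hγ s t) hderiv

theorem speedMeasure_eq_zero_of_eqOn {p : E} {U : Set ℝ} (hU : IsOpen U)
    (hγ : ∀ t ∈ U, γ t = p) : speedMeasure γ U = 0 := by
  rw [speedMeasure, withDensity_apply']
  refine setLIntegral_eq_zero hU.measurableSet fun t ht ↦ ?_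
  have hconst : γ =ᶠ[𝓝 t] fun _ ↦ p := by
    filter_upwards [hU.mem_nhds ht] with r hr using hγ r hr
  simp [hconst.deriv_eq]

end Speed

section Area

theorem hausdorffMeasure_image_le_of_edist_le {ι X Y : Type*} [EMetricSpace X]
    [MeasurableSpace X] [BorelSpace X] [EMetricSpace Y] [MeasurableSpace Y] [BorelSpace Y]
    {f : ι → X} {g : ι → Y} {A : Set ι}
    (h : ∀ x ∈ A, ∀ y ∈ A, edist (f x) (f y) ≤ edist (g x) (g y)) {d : ℝ} (hd : 0 ≤ d) :
    μH[d] (f '' A) ≤ μH[d] (g '' A) := by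
  rcases A.eq_empty_or_nonempty with rfl | ⟨x₀, -⟩
  · simp
  have : Nonempty ι := ⟨x₀⟩
  choose! σ hσA hgσ using fun z (hz : z ∈ g '' A) ↦ hz
  have hlip : LipschitzOnWith 1 (f ∘ σ) (g '' A) := fun z hz w hw ↦ by
    simpa [hgσ z hz, hgσ w hw] using h _ (hσA z hz) _ (hσA w hw)
  have hsub : f '' A ⊆ (f ∘ σ) '' (g '' A) := by
    rintro _ ⟨x, hx, rfl⟩
    have hgx := mem_image_of_mem g hx
    refine ⟨g x, hgx, edist_le_zero.1 ?_⟩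
    simpa [hgσ _ hgx] using h _ (hσA _ hgx) x hx
  simpa using (measure_mono hsub).trans (hlip.hausdorffMeasure_image_le hd)

theorem volume_image_le_lintegral_of_ae_hasDerivAt {v v' : ℝ → ℝ} {K : ℝ≥0}
    (hv : LipschitzWith K v) (hv' : ∀ᵐ t, HasDerivAt v (v' t) t) {A : Set ℝ}
    (hA : MeasurableSet A) : volume (v '' A) ≤ ∫⁻ t in A, ‖v' t‖ₑ := by
  set N : Set ℝ := toMeasurable volume {t | ¬HasDerivAt v (v' t) t}
  have hnull : volume (v '' N) = 0 := by
    have := hv.hausdorffMeasure_image_le zero_le_one N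
    rw [hausdorffMeasure_real, measure_toMeasurable, ae_iff.1 hv', mul_zero] at this
    exact nonpos_iff_eq_zero.1 this
  have hdiff : ∀ t ∈ A \ N, HasFDerivWithinAt v (.toSpanSingleton ℝ (v' t)) (A \ N) t :=
    fun t ht ↦ (not_not.1 fun h ↦ ht.2 (subset_toMeasurable _ _ h)).hasFDerivAt.hasFDerivWithinAt
  calc volume (v '' A) ≤ volume (v '' (A \ N)) + volume (v '' N) := by
        refine (measure_mono ?_).trans (measure_union_le _ _)
        rw [← image_union, sdiff_union_self]
        exact image_mono subset_union_left
    _ ≤ ∫⁻ t in A \ N, ‖v' t‖ₑ := by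
        rw [hnull, add_zero]
        simpa [ContinuousLinearMap.det_toSpanSingleton, Real.enorm_eq_ofReal_abs] using
          addHaar_image_le_lintegral_abs_det_fderiv volume
            (hA.diff (measurableSet_toMeasurable _ _)) hdiff
    _ ≤ ∫⁻ t in A, ‖v' t‖ₑ := lintegral_mono_set sdiff_subset

variable {E : Type*} [NormedAddCommGroup E] [NormedSpace ℝ E] [FiniteDimensional ℝ E]
  [MeasurableSpace E] [BorelSpace E] {γ : ℝ → E} {K : ℝ≥0}

-- The arclength `v` satisfies `dist (γ s) (γ t) ≤ |v s - v t|` and `v' = ‖γ'‖` almost everywhere,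
-- so that the claim reduces to the change of variables formula for `v`.
theorem hausdorffMeasure_image_le_speedMeasure (hγ : LipschitzWith K γ) {A : Set ℝ}
    (hA : MeasurableSet A) : μH[1] (γ '' A) ≤ speedMeasure γ A := by
  set v : ℝ → ℝ := fun t ↦ ∫ r in 0..t, ‖deriv γ r‖
  have hint := intervalIntegrable_norm_deriv hγ
  have hvsub (s t : ℝ) : v t - v s = ∫ r in s..t, ‖deriv γ r‖ :=
    intervalIntegral.integral_interval_sub_left (hint 0 t) (hint 0 s)
  have hv : LipschitzWith K v := LipschitzWith.of_dist_le_mul fun t s ↦ by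
    rw [Real.dist_eq, Real.dist_eq, hvsub, ← Real.norm_eq_abs]
    refine intervalIntegral.norm_integral_le_of_norm_le_const fun r _ ↦ ?_
    simpa using norm_deriv_le_of_lipschitz hγ
  have hv' := LocallyIntegrable.ae_hasDerivAt_integral (locallyIntegrable_norm_deriv hγ)
  have hγv (s t : ℝ) : edist (γ s) (γ t) ≤ edist (v s) (v t) := by
    wlog hst : s ≤ t generalizing s t
    · simpa only [edist_comm] using this t s (le_of_not_ge hst)
    rw [edist_comm, edist_comm (v s), edist_dist, edist_dist, dist_eq_norm, Real.dist_eq, hvsub]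
    exact ENNReal.ofReal_le_ofReal
      ((norm_sub_le_integral_norm_deriv hγ hst).trans (le_abs_self _))
  calc μH[1] (γ '' A) ≤ μH[1] (v '' A) :=
        hausdorffMeasure_image_le_of_edist_le (fun s _ t _ ↦ hγv s t) zero_le_one
    _ = volume (v '' A) := by rw [hausdorffMeasure_real]
    _ ≤ ∫⁻ t in A, ‖‖deriv γ t‖‖ₑ :=
        volume_image_le_lintegral_of_ae_hasDerivAt hv
          (hv'.mono fun t ht ↦ ht 0) hA
    _ = speedMeasure γ A := by simp [speedMeasure, withDensity_apply']

theorem restrict_hausdorffMeasure_image_le_map (hγ : LipschitzWith K γ) {A : Set ℝ}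
    (hA : MeasurableSet A) :
    (μH[1]).restrict (γ '' A) ≤ ((speedMeasure γ).restrict A).map γ := by
  have hγm : Measurable γ := hγ.continuous.measurable
  refine Measure.le_iff.2 fun B hB ↦ ?_
  rw [Measure.restrict_apply hB, Measure.map_apply hγm hB, Measure.restrict_apply (hγm hB),
    inter_comm, ← image_inter_preimage, inter_comm]
  exact hausdorffMeasure_image_le_speedMeasure hγ ((hγm hB).inter hA)

end Area

section Semicontinuity

theorem liminf_add_liminf_le {ι : Type*} {f : Filter ι} (u v : ι → ℝ≥0∞) :
    liminf u f + liminf v f ≤ liminf (fun j ↦ u j + v j) f := by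
  rw [liminf_eq_iSup_iInf, liminf_eq_iSup_iInf]
  refine ENNReal.biSup_add_biSup_le ⟨univ, univ_mem⟩ ⟨univ, univ_mem⟩ fun A hA B hB ↦ ?_
  refine le_liminf_of_le (by isBoundedDefault) ?_
  filter_upwards [hA, hB] with j hjA hjB
  exact add_le_add (iInf₂_le j hjA) (iInf₂_le j hjB)

theorem lintegral_eq_lintegral_measure_ofReal_lt {α : Type*} [MeasurableSpace α] (μ : Measure α)
    [SFinite μ] {f : α → ℝ≥0∞} (hf : Measurable f) :
    ∫⁻ x, f x ∂μ = ∫⁻ r in Ioi (0 : ℝ), μ {x | ENNReal.ofReal r < f x} := by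
  have hm : MeasurableSet {p : α × ℝ | ENNReal.ofReal p.2 < f p.1} :=
    measurableSet_lt (by fun_prop) (by fun_prop)
  have hlayer (c : ℝ≥0∞) : volume.restrict (Ioi 0) {r : ℝ | ENNReal.ofReal r < c} = c := by
    rw [Measure.restrict_apply (measurableSet_lt ENNReal.measurable_ofReal measurable_const)]
    rcases eq_or_ne c ∞ with rfl | hc
    · simp
    · have hIoo : {r : ℝ | ENNReal.ofReal r < c} ∩ Ioi 0 = Ioo 0 c.toReal := by
        ext r
        simp +contextual [and_comm, ENNReal.ofReal_lt_iff_lt_toReal, hc, le_of_lt]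
      rw [hIoo, Real.volume_Ioo, sub_zero, ENNReal.ofReal_toReal hc]
  calc ∫⁻ x, f x ∂μ
      = ∫⁻ x, volume.restrict (Ioi 0) {r : ℝ | ENNReal.ofReal r < f x} ∂μ :=
        lintegral_congr fun x ↦ (hlayer (f x)).symm
    _ = (μ.prod (volume.restrict (Ioi 0))) {p : α × ℝ | ENNReal.ofReal p.2 < f p.1} :=
        (Measure.prod_apply hm).symm
    _ = _ := Measure.prod_apply_symm hm

theorem edist_le_hausdorffMeasure_image {X : Type*} [MetricSpace X]
    [MeasurableSpace X] [BorelSpace X] {γ : ℝ → X} {s t : ℝ}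
    (hst : s ≤ t) (hγ : ContinuousOn γ (Icc s t)) :
    edist (γ s) (γ t) ≤ μH[1] (γ '' Icc s t) := by
  have hlip : LipschitzWith 1 fun z ↦ dist z (γ s) := LipschitzWith.dist_left _
  have hsub : Icc 0 (dist (γ t) (γ s)) ⊆ (fun z ↦ dist z (γ s)) '' (γ '' Icc s t) := by
    rw [image_image]
    simpa using intermediate_value_Icc hst (hlip.continuous.comp_continuousOn hγ)
  calc edist (γ s) (γ t) = volume (Icc 0 (dist (γ t) (γ s))) := by
        rw [Real.volume_Icc, sub_zero, edist_comm, edist_dist]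
    _ ≤ volume ((fun z ↦ dist z (γ s)) '' (γ '' Icc s t)) := measure_mono hsub
    _ ≤ μH[1] (γ '' Icc s t) := by
        simpa [hausdorffMeasure_real] using
          hlip.hausdorffMeasure_image_le zero_le_one (γ '' Icc s t)

variable {E : Type*} [NormedAddCommGroup E] [NormedSpace ℝ E] [FiniteDimensional ℝ E]
  [MeasurableSpace E] [BorelSpace E] {γs : ℕ → ℝ → E} {γ : ℝ → E} {Ks : ℕ → ℝ≥0} {K : ℝ≥0}
  {s t : ℝ}

theorem hausdorffMeasure_image_Icc_inter_le (hγ : LipschitzWith K γ) {A : Set E}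
    (hA : MeasurableSet A) (s t : ℝ) :
    μH[1] (γ '' Icc s t ∩ A) ≤ speedMeasure γ (Ioc s t ∩ γ ⁻¹' A) := by
  rw [measure_congr (speedMeasure_absolutelyContinuous.ae_eq
    (ae_eq_set_inter Ioc_ae_eq_Icc (ae_eq_refl (γ ⁻¹' A)))), ← image_inter_preimage]
  exact hausdorffMeasure_image_le_speedMeasure hγ
    (measurableSet_Icc.inter (hγ.continuous.measurable hA))

theorem edist_le_speedMeasure_compl_add (hγ : LipschitzWith K γ) {A : Set E}
    (hA : MeasurableSet A) (hst : s ≤ t) :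
    edist (γ s) (γ t) ≤ speedMeasure γ (Ioc s t ∩ γ ⁻¹' Aᶜ) + μH[1] (γ '' Icc s t ∩ A) :=
  calc edist (γ s) (γ t) ≤ μH[1] (γ '' Icc s t) :=
        edist_le_hausdorffMeasure_image hst hγ.continuous.continuousOn
    _ ≤ μH[1] (γ '' Icc s t ∩ Aᶜ) + μH[1] (γ '' Icc s t ∩ A) := by
        rw [add_comm, ← sdiff_eq]
        exact measure_le_inter_add_sdiff _ _ _
    _ ≤ _ := by grw [hausdorffMeasure_image_Icc_inter_le hγ hA.compl s t]

-- The curves eventually run in any given closed thickening of the image of `γ`, so the length that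
-- the images gain inside `A` is controlled by continuity from above of `μH[1]` restricted to `A`.
theorem edist_le_liminf_speedMeasure_compl_add {A : Set E} (hA : MeasurableSet A)
    (hAfin : μH[1] A ≠ ∞) (hγs : ∀ j, LipschitzWith (Ks j) (γs j)) (hγ : LipschitzWith K γ)
    (hst : s ≤ t) (hlim : TendstoUniformlyOn γs γ atTop (Icc s t)) :
    edist (γ s) (γ t) ≤
      liminf (fun j ↦ speedMeasure (γs j) (Ioc s t ∩ γs j ⁻¹' Aᶜ)) atTop +
        speedMeasure γ (Ioc s t ∩ γ ⁻¹' A) := by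
  set μ : Measure E := μH[1].restrict A with hμ
  have : IsFiniteMeasure μ := isFiniteMeasure_restrict.2 hAfin
  have hcompact : IsCompact (γ '' Icc s t) := isCompact_Icc.image hγ.continuous
  have hthick (δ : ℝ) (hδ : 0 < δ) :
      edist (γ s) (γ t) - μ (Metric.cthickening δ (γ '' Icc s t)) ≤
        liminf (fun j ↦ speedMeasure (γs j) (Ioc s t ∩ γs j ⁻¹' Aᶜ)) atTop := by
    have hedist := ENNReal.Tendsto.sub
      ((hlim.tendsto_at (left_mem_Icc.2 hst)).edist (hlim.tendsto_at (right_mem_Icc.2 hst)))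
      (tendsto_const_nhds (x := μ (Metric.cthickening δ (γ '' Icc s t))))
      (Or.inr (measure_ne_top _ _))
    rw [← hedist.liminf_eq]
    refine liminf_le_liminf ?_
    filter_upwards [Metric.tendstoUniformlyOn_iff.1 hlim δ hδ] with j hj
    have hsub : γs j '' Icc s t ⊆ Metric.cthickening δ (γ '' Icc s t) := by
      rintro _ ⟨r, hr, rfl⟩
      exact Metric.mem_cthickening_of_dist_le _ (γ r) _ _ (mem_image_of_mem _ hr)
        (dist_comm (γ r) _ ▸ (hj r hr).le)
    rw [tsub_le_iff_right, hμ, Measure.restrict_apply Metric.isClosed_cthickening.measurableSet]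
    grw [edist_le_speedMeasure_compl_add (hγs j) hA hst, hsub]
  have hμγ : μ (γ '' Icc s t) ≤ speedMeasure γ (Ioc s t ∩ γ ⁻¹' A) := by
    rw [hμ, Measure.restrict_apply hcompact.measurableSet]
    exact hausdorffMeasure_image_Icc_inter_le hγ hA s t
  have hμlim : Tendsto (fun δ ↦ μ (Metric.cthickening δ (γ '' Icc s t))) (𝓝[>] 0)
      (𝓝 (μ (γ '' Icc s t))) :=
    (tendsto_measure_cthickening_of_isCompact hcompact).mono_left nhdsWithin_le_nhds
  grw [← hμγ, ← tsub_le_iff_right]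
  exact le_of_tendsto (ENNReal.Tendsto.sub tendsto_const_nhds hμlim
    (Or.inr (measure_ne_top _ _))) (eventually_nhdsWithin_of_forall hthick)

theorem measure_Ioc_inter_add {μ : Measure ℝ} {B : Set ℝ} (hB : MeasurableSet B) {r s t : ℝ}
    (hrs : r ≤ s) (hst : s ≤ t) :
    μ (Ioc r s ∩ B) + μ (Ioc s t ∩ B) = μ (Ioc r t ∩ B) := by
  rw [← Ioc_union_Ioc_eq_Ioc hrs hst, union_inter_distrib_right,
    measure_union _ (measurableSet_Ioc.inter hB)]
  exact (Ioc_disjoint_Ioc_of_le le_rfl).mono inter_subset_left inter_subset_left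

theorem speedMeasure_compl_le_liminf {A : Set E} (hA : MeasurableSet A)
    (hAfin : μH[1] A ≠ ∞) (hγs : ∀ j, LipschitzWith (Ks j) (γs j)) (hγ : LipschitzWith K γ)
    (hlim : TendstoUniformlyOn γs γ atTop (Icc s t)) :
    speedMeasure γ (Ioc s t ∩ γ ⁻¹' Aᶜ) ≤
      liminf (fun j ↦ speedMeasure (γs j) (Ioc s t ∩ γs j ⁻¹' Aᶜ)) atTop := by
  rcases lt_or_ge t s with hts | hst
  · simp [Ioc_eq_empty_of_le hts.le]
  have hγA := hγ.continuous.measurable hA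
  have hfin : speedMeasure γ (Ioc s t ∩ γ ⁻¹' A) ≠ ∞ :=
    measure_ne_top_of_subset inter_subset_left (speedMeasure_Ioc_ne_top hγ s t)
  have hlength : speedMeasure γ (Icc s t) ≤
      liminf (fun j ↦ speedMeasure (γs j) (Ioc s t ∩ γs j ⁻¹' Aᶜ)) atTop +
        speedMeasure γ (Ioc s t ∩ γ ⁻¹' A) := by
    refine speedMeasure_Icc_le_of_superadditive (Φ := fun r r' ↦
      liminf (fun j ↦ speedMeasure (γs j) (Ioc r r' ∩ γs j ⁻¹' Aᶜ)) atTop +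
        speedMeasure γ (Ioc r r' ∩ γ ⁻¹' A)) hst ?_ ?_
    · intro r hr r' hr' hrr'
      exact edist_le_liminf_speedMeasure_compl_add hA hAfin hγs hγ hrr'
        (hlim.mono (Icc_subset_Icc hr.1 hr'.2))
    · intro r hr r' _ hrr'
      rw [add_add_add_comm, measure_Ioc_inter_add hγA hr.1 hrr']
      grw [liminf_add_liminf_le]
      simp only [measure_Ioc_inter_add ((hγs _).continuous.measurable hA.compl) hr.1 hrr', le_refl]
  rw [← measure_congr (speedMeasure_absolutelyContinuous.ae_eq Ioc_ae_eq_Icc),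
    ← measure_inter_add_sdiff _ hγA, add_comm] at hlength
  exact (ENNReal.add_le_add_iff_right hfin).1 hlength

end Semicontinuity

section Cost

variable {E : Type*} [NormedAddCommGroup E] [NormedSpace ℝ E]

/-- The measure `F (γ t) ‖γ'(t)‖ dt` on the line, giving a set of times the cost of travelling along
`γ` during it when the friction coefficient is `F`. -/
def costMeasure (F : E → ℝ≥0∞) (γ : ℝ → E) : Measure ℝ :=
  (speedMeasure γ).withDensity fun t ↦ F (γ t)

theorem costMeasure_absolutelyContinuous {F : E → ℝ≥0∞} {γ : ℝ → E} :
    costMeasure F γ ≪ speedMeasure γ :=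
  withDensity_absolutelyContinuous _ _

theorem costMeasure_Icc {F : E → ℝ≥0∞} {γ : ℝ → E} (s t : ℝ) :
    costMeasure F γ (Icc s t) = costMeasure F γ (Ioc s t) :=
  measure_congr ((costMeasure_absolutelyContinuous.trans
    speedMeasure_absolutelyContinuous).ae_eq Ioc_ae_eq_Icc.symm)

theorem costMeasure_Icc_eq_zero_of_forall_Ioo {F : E → ℝ≥0∞} {γ : ℝ → E} {s t : ℝ} {p : E}
    (hγ : ∀ r ∈ Ioo s t, γ r = p) : costMeasure F γ (Icc s t) = 0 := by
  refine costMeasure_absolutelyContinuous ?_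
  rw [← measure_congr (speedMeasure_absolutelyContinuous.ae_eq Ioo_ae_eq_Icc)]
  exact speedMeasure_eq_zero_of_eqOn isOpen_Ioo hγ

theorem costMeasure_Ioc_add {F : E → ℝ≥0∞} {γ : ℝ → E} {r s t : ℝ} (hrs : r ≤ s) (hst : s ≤ t) :
    costMeasure F γ (Ioc r s) + costMeasure F γ (Ioc s t) = costMeasure F γ (Ioc r t) := by
  simpa using measure_Ioc_inter_add (μ := costMeasure F γ) MeasurableSet.univ hrs hst

theorem costMeasure_eq_lintegral_speedMeasure {F : E → ℝ≥0∞} {γ : ℝ → E}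
    (hFγ : Measurable fun t ↦ F (γ t)) {A : Set ℝ} (hA : MeasurableSet A) :
    costMeasure F γ A =
      ∫⁻ r in Ioi (0 : ℝ), speedMeasure γ (A ∩ γ ⁻¹' {z | F z ≤ ENNReal.ofReal r}ᶜ) := by
  rw [costMeasure, withDensity_apply _ hA, lintegral_eq_lintegral_measure_ofReal_lt _ hFγ]
  refine lintegral_congr fun r ↦ ?_
  rw [Measure.restrict_apply (measurableSet_lt measurable_const hFγ), inter_comm, compl_ofPred]
  simp only [not_le, preimage_ofPred_eq]

theorem speedMeasure_le_costMeasure_div {F : E → ℝ≥0∞} {γ : ℝ → E}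
    (hFγ : Measurable fun t ↦ F (γ t)) {A : Set ℝ} {lam : ℝ≥0∞} (hlam : lam ≠ 0)
    (hlam' : lam ≠ ∞) (hA : ∀ t ∈ A, lam ≤ F (γ t)) :
    speedMeasure γ A ≤ costMeasure F γ A / lam := by
  rw [ENNReal.le_div_iff_mul_le (Or.inl hlam) (Or.inl hlam'), mul_comm, costMeasure,
    withDensity_apply', ← setLIntegral_const]
  exact setLIntegral_mono hFγ hA

theorem exists_ne_costMeasure_uIoc_le {F : E → ℝ≥0∞} {γ : ℝ → E}
    (hfin : costMeasure F γ (Ioc 0 1) ≠ ∞) {p : ℝ} (hp : p ∈ Icc (0 : ℝ) 1)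
    (hne : ∃ t ∈ Icc (0 : ℝ) 1, γ t ≠ γ p) {ε : ℝ≥0∞} (hε : ε ≠ 0) :
    ∃ t ∈ Icc (0 : ℝ) 1, γ t ≠ γ p ∧ costMeasure F γ (uIoc p t) ≤ ε := by
  set T : Set ℝ := {t ∈ Icc 0 1 | γ t ≠ γ p}
  set d : ℝ := Metric.infDist p T
  set ν : Measure ℝ := (costMeasure F γ).restrict (Icc 0 1) with hν
  have : IsFiniteMeasure ν := isFiniteMeasure_restrict.2 ((costMeasure_Icc 0 1).trans_ne hfin)
  have hconst : ν (Metric.closedBall p d) = 0 := by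
    rw [hν, Measure.restrict_apply Metric.isClosed_closedBall.measurableSet,
      Real.closedBall_eq_Icc, Icc_inter_Icc]
    refine costMeasure_Icc_eq_zero_of_forall_Ioo (p := γ p) fun t ht ↦ not_not.1 fun htp ↦ ?_
    simp only [mem_Ioo, sup_lt_iff, lt_inf_iff] at ht
    have hdist : d ≤ dist p t := Metric.infDist_le_dist_of_mem ⟨⟨ht.1.2.le, ht.2.2.le⟩, htp⟩
    rw [Real.dist_eq, le_abs'] at hdist
    rcases hdist with h | h <;> linarith [ht.1.1, ht.2.1]
  have hthick : Tendsto (fun δ ↦ ν (Metric.cthickening δ (Metric.closedBall p d))) (𝓝[>] 0)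
      (𝓝 (ν (Metric.closedBall p d))) :=
    (tendsto_measure_cthickening_of_isClosed ⟨1, one_pos, measure_ne_top _ _⟩
      Metric.isClosed_closedBall).mono_left nhdsWithin_le_nhds
  rw [hconst] at hthick
  obtain ⟨δ, hδε, hδ : 0 < δ⟩ :=
    ((hthick.eventually_le_const (pos_iff_ne_zero.2 hε)).and self_mem_nhdsWithin).exists
  obtain ⟨t, ⟨htI, htp⟩, htδ⟩ := (Metric.infDist_lt_iff hne).1 (lt_add_of_pos_right d hδ)
  refine ⟨t, htI, htp, le_trans ?_ hδε⟩
  rw [cthickening_closedBall hδ.le Metric.infDist_nonneg, hν,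
    Measure.restrict_apply Metric.isClosed_closedBall.measurableSet]
  refine measure_mono (uIoc_subset_uIcc.trans <|
    subset_inter ?_ (ordConnected_Icc.uIcc_subset hp htI))
  rw [← segment_eq_uIcc]
  refine (convex_closedBall p _).segment_subset (Metric.mem_closedBall_self ?_) ?_
  · exact add_nonneg hδ.le Metric.infDist_nonneg
  · rw [Metric.mem_closedBall, dist_comm, add_comm]
    exact htδ.le

variable [FiniteDimensional ℝ E] [MeasurableSpace E] [BorelSpace E] {F : E → ℝ≥0∞}
  {γs : ℕ → ℝ → E} {γ : ℝ → E} {Ks : ℕ → ℝ≥0} {K : ℝ≥0} {s t : ℝ}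

theorem setLIntegral_image_le_costMeasure (hF : Measurable F) (hγ : LipschitzWith K γ) {A : Set ℝ}
    (hA : MeasurableSet A) : ∫⁻ z in γ '' A, F z ∂μH[1] ≤ costMeasure F γ A :=
  calc ∫⁻ z in γ '' A, F z ∂μH[1] ≤ ∫⁻ z, F z ∂((speedMeasure γ).restrict A).map γ :=
        lintegral_mono' (restrict_hausdorffMeasure_image_le_map hγ hA) le_rfl
    _ = costMeasure F γ A := by
        rw [lintegral_map hF hγ.continuous.measurable, costMeasure, withDensity_apply _ hA]

theorem costMeasure_Ioc_le_liminf (hF : Measurable F) {a : ℝ≥0∞} (hFa : ∀ z, F z ≤ a)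
    (hfin : ∀ lam < a, μH[1] {z | F z ≤ lam} ≠ ∞) (hγs : ∀ j, LipschitzWith (Ks j) (γs j))
    (hγ : LipschitzWith K γ) (hlim : TendstoUniformlyOn γs γ atTop (Icc s t)) :
    costMeasure F γ (Ioc s t) ≤ liminf (fun j ↦ costMeasure F (γs j) (Ioc s t)) atTop := by
  have hlayer {σ : ℝ → E} {L : ℝ≥0} (hσ : LipschitzWith L σ) :=
    costMeasure_eq_lintegral_speedMeasure (γ := σ) (hF.comp hσ.continuous.measurable)
      (measurableSet_Ioc (a := s) (b := t))
  simp only [hlayer hγ, fun j ↦ hlayer (hγs j)]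
  refine le_trans (lintegral_mono fun r ↦ ?_) (lintegral_liminf_le fun j ↦ ?_)
  · rcases lt_or_ge (ENNReal.ofReal r) a with hr | hr
    · exact speedMeasure_compl_le_liminf (measurableSet_le hF measurable_const) (hfin _ hr)
        hγs hγ hlim
    · have huniv : {z | F z ≤ ENNReal.ofReal r} = univ :=
        eq_univ_of_forall fun z ↦ (hFa z).trans hr
      simp [huniv]
  · refine Antitone.measurable fun r r' hrr' ↦ measure_mono ?_
    refine inter_subset_inter_right _ (preimage_mono (compl_subset_compl.2 fun z hz ↦ ?_))
    exact le_trans hz (ENNReal.ofReal_le_ofReal hrr')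

-- Away from `γ '' Icc s t`, the cost of a curve outside `{F ≤ lam}` is at least `lam` times its
-- length, while `{F ≤ lam}` takes up no length of `γ` once this image is removed from it.
theorem eventually_exists_eq_of_costMeasure_le (hF : Measurable F)
    (hfin : ∀ lam < ∞, μH[1] {z | F z ≤ lam} ≠ ∞) (hγs : ∀ j, LipschitzWith (Ks j) (γs j))
    (hγ : LipschitzWith K γ) (hne : γ s ≠ γ t)
    (hlim : TendstoUniformlyOn γs γ atTop (uIcc s t)) {M : ℝ≥0}
    (hM : ∀ j, costMeasure F (γs j) (uIoc s t) ≤ M) :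
    ∀ᶠ j in atTop, ∃ u ∈ uIcc s t, ∃ v ∈ uIcc s t, γs j u = γ v := by
  wlog hst : s ≤ t generalizing s t
  · simpa only [uIcc_comm] using this hne.symm (uIcc_comm s t ▸ hlim)
      (uIoc_comm s t ▸ hM) (le_of_not_ge hst)
  rw [uIcc_of_le hst] at hlim ⊢
  rw [uIoc_of_le hst] at hM
  by_contra hdisj
  rw [not_eventually] at hdisj
  have hedist (lam : ℝ≥0) (hlam : lam ≠ 0) : edist (γ s) (γ t) ≤ M / lam := by
    have hA : MeasurableSet ({z | F z ≤ lam} \ γ '' Icc s t) :=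
      (measurableSet_le hF measurable_const).diff
        (isCompact_Icc.image hγ.continuous).measurableSet
    have hle := edist_le_liminf_speedMeasure_compl_add hA
      (measure_ne_top_of_subset sdiff_subset (hfin lam ENNReal.coe_lt_top)) hγs hγ hst hlim
    have hempty : Ioc s t ∩ γ ⁻¹' ({z | F z ≤ lam} \ γ '' Icc s t) = ∅ :=
      eq_empty_of_forall_notMem fun r hr ↦
        hr.2.2 (mem_image_of_mem _ (Ioc_subset_Icc_self hr.1))
    rw [hempty, measure_empty, add_zero] at hle
    refine hle.trans (liminf_le_of_frequently_le' (hdisj.mono fun j hj ↦ ?_))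
    grw [speedMeasure_le_costMeasure_div (γ := γs j) (hF.comp (hγs j).continuous.measurable)
      (ENNReal.coe_ne_zero.2 hlam) ENNReal.coe_ne_top, inter_subset_left, hM j]
    intro r hr
    by_contra! hlt
    exact hr.2 ⟨hlt.le, fun ⟨v, hv, hvr⟩ ↦ hj ⟨r, Ioc_subset_Icc_self hr.1, v, hv, hvr.symm⟩⟩
  have hzero : Tendsto (fun k : ℕ ↦ (M : ℝ≥0∞) / k) atTop (𝓝 0) := by
    simpa using ENNReal.Tendsto.const_div ENNReal.tendsto_nat_nhds_top
      (Or.inr (ENNReal.coe_ne_top (r := M)))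
  refine hne (edist_le_zero.1 (ge_of_tendsto hzero ?_))
  filter_upwards [eventually_ne_atTop 0] with k hk
  exact_mod_cast hedist k (Nat.cast_ne_zero.2 hk)

end Cost

section Distance

variable {E : Type*} [NormedAddCommGroup E]

/-- `γ` restricted to `[0,1]` is a Lipschitz path from `x` to `y` in `Q`, as in `IsPath` but with
an unspecified Lipschitz constant and in an arbitrary set. -/
structure IsLipschitzPath (Q : Set E) (x y : E) (γ : ℝ → E) : Prop where
  lipschitz : ∃ K : ℝ≥0, LipschitzOnWith K γ (Icc 0 1)
  mapsTo : MapsTo γ (Icc 0 1) Q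
  source : γ 0 = x
  target : γ 1 = y

/-- The length of a path on `[0,1]` weighted by the friction coefficient `F`, generalizing
`length`. -/
def weightedLength [NormedSpace ℝ E] (F : E → ℝ≥0∞) (γ : ℝ → E) : ℝ≥0∞ :=
  ∫⁻ t in Icc (0 : ℝ) 1, F (γ t) * ‖derivWithin γ (Icc 0 1) t‖ₑ

/-- The infimum over all Lipschitz paths in `Q` from `x` to `y` of the integral of `F` over their
image, generalizing `urbanDist`. -/
def weightedDist [MeasurableSpace E] [BorelSpace E] (Q : Set E) (F : E → ℝ≥0∞) (x y : E) : ℝ≥0∞ :=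
  ⨅ (γ : ℝ → E) (_ : IsLipschitzPath Q x y γ), ∫⁻ z in γ '' Icc 0 1, F z ∂μH[1]

variable {Q : Set E} {F : E → ℝ≥0∞} {x y z : E} {γ : ℝ → E}

theorem IsLipschitzPath.exists_lipschitzWith_eqOn (hγ : IsLipschitzPath Q x y γ) :
    ∃ (K : ℝ≥0) (σ : ℝ → E), LipschitzWith K σ ∧ EqOn γ σ (Icc 0 1) := by
  obtain ⟨K, hK⟩ := hγ.lipschitz
  refine ⟨K, fun t ↦ γ (projIcc 0 1 zero_le_one t), ?_, fun t ht ↦ ?_⟩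
  · simpa using! hK.to_restrict.comp (LipschitzWith.projIcc zero_le_one)
  · simp only [projIcc_of_mem zero_le_one ht]

theorem IsLipschitzPath.symm (hγ : IsLipschitzPath Q x y γ) :
    IsLipschitzPath Q y x fun t ↦ γ (1 - t) := by
  have hmaps : MapsTo (fun t : ℝ ↦ 1 - t) (Icc 0 1) (Icc 0 1) := fun t ht ↦
    ⟨sub_nonneg.2 ht.2, sub_le_self 1 ht.1⟩
  obtain ⟨K, hK⟩ := hγ.lipschitz
  exact
    { lipschitz := ⟨_, hK.comp ((LipschitzWith.const 1).sub LipschitzWith.id).lipschitzOnWith hmaps⟩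
      mapsTo := hγ.mapsTo.comp hmaps
      source := by simpa using hγ.target
      target := by simpa using hγ.source }

theorem IsLipschitzPath.exists_trans {σ τ : ℝ → E} (hσ : IsLipschitzPath Q x y σ)
    (hτ : IsLipschitzPath Q y z τ) :
    ∃ ρ, IsLipschitzPath Q x z ρ ∧ ρ '' Icc 0 1 ⊆ σ '' Icc 0 1 ∪ τ '' Icc 0 1 := by
  set φ : ℝ → ℝ := fun t ↦ min (2 * t) 1
  set ψ : ℝ → ℝ := fun t ↦ max (2 * t - 1) 0
  have hφ : MapsTo φ (Icc 0 1) (Icc 0 1) := fun t ht ↦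
    ⟨le_min (by linarith [ht.1]) zero_le_one, min_le_right _ _⟩
  have hψ : MapsTo ψ (Icc 0 1) (Icc 0 1) := fun t ht ↦
    ⟨le_max_right _ _, max_le (by linarith [ht.2]) zero_le_one⟩
  set ρ : ℝ → E := fun t ↦ σ (φ t) + τ (ψ t) - y
  have himage : ρ '' Icc 0 1 ⊆ σ '' Icc 0 1 ∪ τ '' Icc 0 1 := by
    rintro _ ⟨t, ht, rfl⟩
    rcases le_total t (1 / 2) with h | h
    · have hψt : ψ t = 0 := max_eq_right (by linarith)
      exact Or.inl ⟨φ t, hφ ht, by simp [ρ, hψt, hτ.source]⟩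
    · have hφt : φ t = 1 := min_eq_right (by linarith)
      exact Or.inr ⟨ψ t, hψ ht, by simp [ρ, hφt, hσ.target]⟩
  have htwo : LipschitzWith 2 fun t : ℝ ↦ 2 * t := by
    simpa using lipschitzWith_smul (α := ℝ) (β := ℝ) 2
  obtain ⟨Kσ, hKσ⟩ := hσ.lipschitz
  obtain ⟨Kτ, hKτ⟩ := hτ.lipschitz
  have hρ : LipschitzOnWith (Kσ * 2 + Kτ * (2 + 0) + 0) ρ (Icc 0 1) :=
    ((hKσ.comp (htwo.min_const 1).lipschitzOnWith hφ).add
      (hKτ.comp ((htwo.sub (.const 1)).max_const 0).lipschitzOnWith hψ)).sub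
      (LipschitzWith.const y).lipschitzOnWith
  refine ⟨ρ, ⟨⟨_, hρ⟩, fun t ht ↦ ?_, ?_, ?_⟩, himage⟩
  · rcases himage (mem_image_of_mem ρ ht) with ⟨r, hr, hrt⟩ | ⟨r, hr, hrt⟩
    · exact hrt ▸ hσ.mapsTo hr
    · exact hrt ▸ hτ.mapsTo hr
  · simp [ρ, φ, ψ, hσ.source, hτ.source]
  · norm_num [ρ, φ, ψ, hσ.target, hτ.target]

theorem weightedLength_eq_costMeasure [NormedSpace ℝ E] [CompleteSpace E] {σ : ℝ → E}
    (h : EqOn γ σ (Icc 0 1)) : weightedLength F γ = costMeasure F σ (Ioc 0 1) :=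
  calc weightedLength F γ
      = ∫⁻ t in Ioo (0 : ℝ) 1, F (γ t) * ‖derivWithin γ (Icc 0 1) t‖ₑ :=
        (setLIntegral_congr Ioo_ae_eq_Icc).symm
    _ = ∫⁻ t in Ioo (0 : ℝ) 1, ‖deriv σ t‖ₑ * F (σ t) := by
        refine setLIntegral_congr_fun measurableSet_Ioo fun t ht ↦ ?_
        have htI := Ioo_subset_Icc_self ht
        simp only [derivWithin_congr h (h htI), h htI, mul_comm,
          derivWithin_of_mem_nhds (Icc_mem_nhds ht.1 ht.2)]
    _ = ∫⁻ t in Ioc (0 : ℝ) 1, ‖deriv σ t‖ₑ * F (σ t) := setLIntegral_congr Ioo_ae_eq_Ioc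
    _ = costMeasure F σ (Ioc 0 1) := by
        rw [costMeasure, withDensity_apply', speedMeasure]
        exact (setLIntegral_withDensity_eq_setLIntegral_mul_non_measurable _
          (stronglyMeasurable_deriv σ).enorm _ measurableSet_Ioc
          (ae_of_all _ fun t ↦ enorm_lt_top)).symm

section Metric

variable [MeasurableSpace E] [BorelSpace E]

theorem IsLipschitzPath.weightedDist_le (hγ : IsLipschitzPath Q x y γ) :
    weightedDist Q F x y ≤ ∫⁻ z in γ '' Icc 0 1, F z ∂μH[1] :=
  iInf₂_le γ hγ

theorem weightedDist_comm (x y : E) : weightedDist Q F x y = weightedDist Q F y x := by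
  suffices h : ∀ x y, weightedDist Q F x y ≤ weightedDist Q F y x from (h x y).antisymm (h y x)
  refine fun x y ↦ le_iInf₂ fun γ hγ ↦ hγ.symm.weightedDist_le.trans_eq ?_
  rw [← image_image γ, image_const_sub_Icc, sub_zero, sub_self]

theorem weightedDist_triangle (x y z : E) :
    weightedDist Q F x z ≤ weightedDist Q F x y + weightedDist Q F y z := by
  refine ENNReal.le_iInf₂_add_iInf₂ fun σ hσ τ hτ ↦ ?_
  obtain ⟨ρ, hρ, hρστ⟩ := hσ.exists_trans hτ
  exact hρ.weightedDist_le.trans ((lintegral_mono_set hρστ).trans (lintegral_union_le _ _ _))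

variable [NormedSpace ℝ E]

theorem weightedDist_le_mul_edist (hQ : Convex ℝ Q) {a : ℝ≥0∞} (hFa : ∀ z, F z ≤ a)
    (hx : x ∈ Q) (hy : y ∈ Q) : weightedDist Q F x y ≤ a * edist x y := by
  have hpath : IsLipschitzPath Q x y (AffineMap.lineMap x y) :=
    { lipschitz := ⟨_, (lipschitzWith_lineMap x y).lipschitzOnWith⟩
      mapsTo := fun r hr ↦ hQ.lineMap_mem hx hy hr
      source := AffineMap.lineMap_apply_zero x y
      target := AffineMap.lineMap_apply_one x y }
  refine hpath.weightedDist_le.trans ?_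
  rw [← segment_eq_image_lineMap, ← hausdorffMeasure_segment, ← setLIntegral_const]
  exact lintegral_mono hFa

theorem weightedDist_le_costMeasure_uIoc [FiniteDimensional ℝ E] (hF : Measurable F) {K : ℝ≥0}
    (hγ : LipschitzWith K γ) {u v : ℝ} (hγQ : MapsTo γ (uIcc u v) Q) :
    weightedDist Q F (γ u) (γ v) ≤ costMeasure F γ (uIoc u v) := by
  have himage : AffineMap.lineMap u v '' Icc (0 : ℝ) 1 = uIcc u v := by
    rw [← segment_eq_image_lineMap, segment_eq_uIcc]
  have hpath : IsLipschitzPath Q (γ u) (γ v) (γ ∘ AffineMap.lineMap u v) :=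
    { lipschitz := ⟨_, (hγ.comp (lipschitzWith_lineMap u v)).lipschitzOnWith⟩
      mapsTo := hγQ.comp (mapsTo_iff_image_subset.2 himage.subset)
      source := by simp
      target := by simp }
  refine hpath.weightedDist_le.trans ?_
  rw [image_comp, himage, uIoc, ← costMeasure_Icc]
  exact setLIntegral_image_le_costMeasure hF hγ measurableSet_Icc

end Metric

end Distance

section Limit

variable {E : Type*} [NormedAddCommGroup E] [NormedSpace ℝ E] [FiniteDimensional ℝ E]
  [MeasurableSpace E] [BorelSpace E] {Q : Set E} {F : E → ℝ≥0∞} {γs : ℕ → ℝ → E} {γ : ℝ → E}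
  {Ks : ℕ → ℝ≥0} {K : ℝ≥0} {a : ℝ≥0∞}

-- For `a < ∞` convergence already makes `γs j p` close to `γ p`. For `a = ∞` the distance is not
-- controlled by the Euclidean one, but the curves must eventually meet any nontrivial arc of `γ`.
theorem exists_costMeasure_le_eventually_exists_weightedDist_le (hQ : Convex ℝ Q)
    (hF : Measurable F) (hFa : ∀ z, F z ≤ a) (hfin : ∀ lam < a, μH[1] {z | F z ≤ lam} ≠ ∞)
    (hγs : ∀ j, LipschitzWith (Ks j) (γs j)) (hγ : LipschitzWith K γ)
    (hγsQ : ∀ j, MapsTo (γs j) (Icc 0 1) Q) (hγQ : MapsTo γ (Icc 0 1) Q)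
    (hlim : TendstoUniformlyOn γs γ atTop (Icc 0 1)) {M : ℝ≥0}
    (hM : ∀ j, costMeasure F (γs j) (Ioc 0 1) ≤ M) (hcost : costMeasure F γ (Ioc 0 1) ≠ ∞)
    {p : ℝ} (hp : p ∈ Icc (0 : ℝ) 1) (hne : ∃ t ∈ Icc (0 : ℝ) 1, γ t ≠ γ p)
    {ε : ℝ≥0∞} (hε : ε ≠ 0) :
    ∃ q ∈ Icc (0 : ℝ) 1, costMeasure F γ (uIoc p q) ≤ ε ∧
      ∀ᶠ j in atTop, ∃ u ∈ uIcc p q, weightedDist Q F (γs j u) (γ p) ≤ ε := by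
  rcases ne_or_eq a ∞ with ha | rfl
  · refine ⟨p, hp, by simp, ?_⟩
    have hedist : Tendsto (fun j ↦ a * edist (γs j p) (γ p)) atTop (𝓝 0) := by
      have := (hlim.tendsto_at hp).edist (tendsto_const_nhds (x := γ p))
      rw [edist_self] at this
      simpa using ENNReal.Tendsto.const_mul this (Or.inr ha)
    filter_upwards [hedist.eventually_le_const (pos_iff_ne_zero.2 hε)] with j hj
    exact ⟨p, left_mem_uIcc, (weightedDist_le_mul_edist hQ hFa (hγsQ j hp) (hγQ hp)).trans hj⟩
  · obtain ⟨q, hq, hqp, hqε⟩ := exists_ne_costMeasure_uIoc_le hcost hp hne hε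
    have hsub : uIcc p q ⊆ Icc 0 1 := ordConnected_Icc.uIcc_subset hp hq
    have hsub' : uIoc p q ⊆ Ioc 0 1 := Ioc_subset_Ioc (le_min hp.1 hq.1) (max_le hp.2 hq.2)
    refine ⟨q, hq, hqε, ?_⟩
    filter_upwards [eventually_exists_eq_of_costMeasure_le hF hfin hγs hγ hqp.symm
      (hlim.mono hsub) fun j ↦ (measure_mono hsub').trans (hM j)] with j ⟨u, hu, v, hv, huv⟩
    refine ⟨u, hu, ?_⟩
    rw [huv, weightedDist_comm]
    have hpv : uIcc p v ⊆ uIcc p q := uIcc_subset_uIcc_left hv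
    refine (weightedDist_le_costMeasure_uIoc hF hγ (hγQ.mono_left (hpv.trans hsub))).trans ?_
    exact (measure_mono (uIoc_subset_uIoc_of_uIcc_subset_uIcc hpv)).trans hqε

theorem costMeasure_Ioc_le_weightedDist (hF : Measurable F) (hγ : LipschitzWith K γ)
    (hγQ : MapsTo γ (Icc 0 1) Q) (hcost : costMeasure F γ (Ioc 0 1) ≠ ∞)
    (hopt : costMeasure F γ (Ioc 0 1) ≤ weightedDist Q F (γ 0) (γ 1)) {s t : ℝ} (hs : 0 ≤ s)
    (hst : s ≤ t) (ht : t ≤ 1) :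
    costMeasure F γ (Ioc s t) ≤ weightedDist Q F (γ s) (γ t) := by
  have hdist {u v : ℝ} (hu : 0 ≤ u) (huv : u ≤ v) (hv : v ≤ 1) :
      weightedDist Q F (γ u) (γ v) ≤ costMeasure F γ (Ioc u v) := by
    rw [← uIoc_of_le huv]
    exact weightedDist_le_costMeasure_uIoc hF hγ
      (hγQ.mono_left (uIcc_of_le huv ▸ Icc_subset_Icc hu hv))
  have hdetour : costMeasure F γ (Ioc 0 s) + (costMeasure F γ (Ioc s t) +
      costMeasure F γ (Ioc t 1)) ≤ costMeasure F γ (Ioc 0 s) +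
        (weightedDist Q F (γ s) (γ t) + costMeasure F γ (Ioc t 1)) := by
    rw [costMeasure_Ioc_add hst ht, costMeasure_Ioc_add hs (hst.trans ht)]
    grw [hopt, weightedDist_triangle _ (γ s), weightedDist_triangle (γ s) (γ t),
      hdist le_rfl hs (hst.trans ht), hdist (hs.trans hst) ht le_rfl]
  have hsfin : costMeasure F γ (Ioc 0 s) ≠ ∞ :=
    measure_ne_top_of_subset (Ioc_subset_Ioc_right (hst.trans ht)) hcost
  have htfin : costMeasure F γ (Ioc t 1) ≠ ∞ :=
    measure_ne_top_of_subset (Ioc_subset_Ioc_left (hs.trans hst)) hcost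
  exact (ENNReal.add_le_add_iff_right htfin).1 ((ENNReal.add_le_add_iff_left hsfin).1 hdetour)

theorem costMeasure_Ioc_le_add_of_eventually_weightedDist_le
    (hF : Measurable F) (hFa : ∀ z, F z ≤ a) (hfin : ∀ lam < a, μH[1] {z | F z ≤ lam} ≠ ∞)
    (hγs : ∀ j, LipschitzWith (Ks j) (γs j)) (hγ : LipschitzWith K γ)
    (hγsQ : ∀ j, MapsTo (γs j) (Icc 0 1) Q) (hlim : TendstoUniformlyOn γs γ atTop (Icc 0 1))
    (hcost : ∀ j, costMeasure F (γs j) (Ioc 0 1) ≠ ∞)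
    (hopt : ∀ j, costMeasure F (γs j) (Ioc 0 1) ≤ weightedDist Q F (γs j 0) (γs j 1))
    {s t : ℝ} (hs : 0 ≤ s) (hst : s ≤ t) (ht : t ≤ 1) {x y : E} {ε : ℝ≥0∞}
    (hx : ∀ᶠ j in atTop, ∃ u ∈ Icc 0 s, weightedDist Q F (γs j u) x ≤ ε)
    (hy : ∀ᶠ j in atTop, ∃ v ∈ Icc t 1, weightedDist Q F (γs j v) y ≤ ε) :
    costMeasure F γ (Ioc s t) ≤ ε + (weightedDist Q F x y + ε) := by
  refine (costMeasure_Ioc_le_liminf hF hFa hfin hγs hγ (hlim.mono (Icc_subset_Icc hs ht))).trans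
    (liminf_le_of_frequently_le' (Eventually.frequently ?_))
  filter_upwards [hx, hy] with j ⟨u, hu, huε⟩ ⟨v, hv, hvε⟩
  calc costMeasure F (γs j) (Ioc s t)
      ≤ costMeasure F (γs j) (Ioc u v) := measure_mono (Ioc_subset_Ioc hu.2 hv.1)
    _ ≤ weightedDist Q F (γs j u) (γs j v) :=
        costMeasure_Ioc_le_weightedDist hF (hγs j) (hγsQ j) (hcost j) (hopt j) hu.1
          (hu.2.trans (hst.trans hv.1)) hv.2
    _ ≤ ε + (weightedDist Q F x y + ε) := by
        grw [weightedDist_triangle _ x, weightedDist_triangle x y,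
          weightedDist_comm y (γs j v), huε, hvε]

theorem costMeasure_le_weightedDist_of_tendstoUniformlyOn (hQ : Convex ℝ Q)
    (hF : Measurable F) (hFa : ∀ z, F z ≤ a) (hfin : ∀ lam < a, μH[1] {z | F z ≤ lam} ≠ ∞)
    (hγs : ∀ j, LipschitzWith (Ks j) (γs j)) (hγ : LipschitzWith K γ)
    (hγsQ : ∀ j, MapsTo (γs j) (Icc 0 1) Q) (hγQ : MapsTo γ (Icc 0 1) Q)
    (hlim : TendstoUniformlyOn γs γ atTop (Icc 0 1)) {M : ℝ≥0}
    (hM : ∀ j, costMeasure F (γs j) (Ioc 0 1) ≤ M)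
    (hopt : ∀ j, costMeasure F (γs j) (Ioc 0 1) ≤ weightedDist Q F (γs j 0) (γs j 1)) :
    costMeasure F γ (Ioc 0 1) ≤ weightedDist Q F (γ 0) (γ 1) := by
  have hMs (j : ℕ) := ne_top_of_le_ne_top ENNReal.coe_ne_top (hM j)
  have hcost : costMeasure F γ (Ioc 0 1) ≠ ∞ :=
    ne_top_of_le_ne_top ENNReal.coe_ne_top
      ((costMeasure_Ioc_le_liminf hF hFa hfin hγs hγ hlim).trans
        (liminf_le_of_frequently_le' (Frequently.of_forall hM)))
  by_cases hconst : ∃ p ∈ Icc (0 : ℝ) 1, ∀ t ∈ Icc (0 : ℝ) 1, γ t = γ p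
  · obtain ⟨p, -, hp⟩ := hconst
    rw [← costMeasure_Icc,
      costMeasure_Icc_eq_zero_of_forall_Ioo fun t ht ↦ hp t (Ioo_subset_Icc_self ht)]
    exact zero_le
  push Not at hconst
  refine ENNReal.le_of_forall_pos_le_add fun ε hε _ ↦ ?_
  have hη : (ε : ℝ≥0∞) / 4 ≠ 0 := by simp [hε.ne']
  have hnear {p : ℝ} (hp : p ∈ Icc (0 : ℝ) 1) :=
    exists_costMeasure_le_eventually_exists_weightedDist_le hQ hF hFa hfin hγs hγ hγsQ hγQ hlim hM
      hcost hp (hconst p hp) hη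
  obtain ⟨s, hs, hsη, hus⟩ := hnear (left_mem_Icc.2 zero_le_one)
  obtain ⟨t, ht, htη, hvt⟩ := hnear (right_mem_Icc.2 zero_le_one)
  rw [uIoc_of_le hs.1] at hsη
  rw [uIoc_of_ge ht.2] at htη
  simp only [uIcc_of_le hs.1] at hus
  simp only [uIcc_of_ge ht.2] at hvt
  have hmid : costMeasure F γ (Ioc s t) ≤
      ε / 4 + (weightedDist Q F (γ 0) (γ 1) + ε / 4) := by
    rcases lt_or_ge t s with hts | hst
    · simp [Ioc_eq_empty_of_le hts.le]
    exact costMeasure_Ioc_le_add_of_eventually_weightedDist_le hF hFa hfin hγs hγ hγsQ hlim hMs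
      hopt hs.1 hst ht.2 hus hvt
  calc costMeasure F γ (Ioc 0 1)
      ≤ costMeasure F γ (Ioc 0 s) + (costMeasure F γ (Ioc s t) + costMeasure F γ (Ioc t 1)) := by
        grw [Ioc_subset_Ioc_union_Ioc (b := s), measure_union_le,
          Ioc_subset_Ioc_union_Ioc (a := s) (b := t), measure_union_le]
    _ ≤ ε / 4 + ((ε / 4 + (weightedDist Q F (γ 0) (γ 1) + ε / 4)) + ε / 4) := by gcongr
    _ = weightedDist Q F (γ 0) (γ 1) + 4 * (ε / 4) := by ring
    _ = weightedDist Q F (γ 0) (γ 1) + ε := by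
        rw [ENNReal.mul_div_cancel (by simp) (by simp)]

end Limit

section Network

variable {n : ℕ} {S : Set (EuclideanSpace ℝ (Fin n))} {a : ℝ≥0∞}
  {b : EuclideanSpace ℝ (Fin n) → ℝ≥0∞} {x y : EuclideanSpace ℝ (Fin n)}
  {γ : ℝ → EuclideanSpace ℝ (Fin n)}

theorem IsNetwork.friction_le (hS : IsNetwork S a b) (z : EuclideanSpace ℝ (Fin n)) :
    friction S a b z ≤ a := by
  unfold friction
  split_ifs with h
  · exact hS.le_cost z h
  · exact le_rfl

theorem setOf_friction_le_eq_sublevel {lam : ℝ≥0∞} (hlam : lam < a) :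
    {z | friction S a b z ≤ lam} = sublevel S b lam := by
  ext z
  by_cases h : z ∈ S <;> simp [friction, sublevel, h, hlam]

theorem IsNetwork.measurable_friction (hS : IsNetwork S a b) : Measurable (friction S a b) := by
  refine measurable_of_Iic fun lam ↦ ?_
  rcases lt_or_ge lam a with hlam | hlam
  · obtain ⟨v, hv, hSv⟩ := lowerSemicontinuousOn_iff_preimage_Iic.1 hS.lowerSemicontinuousOn lam
    have hpre : friction S a b ⁻¹' Iic lam = S ∩ v := (setOf_friction_le_eq_sublevel hlam).trans hSv
    exact hpre ▸ hS.measurableSet.inter hv.measurableSet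
  · have hpre : friction S a b ⁻¹' Iic lam = univ :=
      eq_univ_of_forall fun z ↦ (hS.friction_le z).trans hlam
    exact hpre ▸ MeasurableSet.univ

theorem IsNetwork.hausdorffMeasure_friction_le_ne_top (hS : IsNetwork S a b) {lam : ℝ≥0∞}
    (hlam : lam < a) : μH[1] {z | friction S a b z ≤ lam} ≠ ∞ := by
  rw [setOf_friction_le_eq_sublevel hlam]
  exact (hS.finite_sublevel lam hlam).ne

theorem IsNetwork.imageCost_eq (hS : IsNetwork S a b) (γ : ℝ → EuclideanSpace ℝ (Fin n)) :
    imageCost S a b γ = ∫⁻ z in γ '' Icc 0 1, friction S a b z ∂μH[1] := by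
  have hon : EqOn b (friction S a b) S := fun z hz ↦ (if_pos hz).symm
  have hoff : EqOn (fun _ ↦ a) (friction S a b) Sᶜ := fun z hz ↦ (if_neg hz).symm
  have hm := hS.measurableSet
  rw [imageCost, ← lintegral_add_compl (friction S a b) hm, inter_comm, sdiff_eq_compl_inter,
    ← Measure.restrict_restrict hm, ← Measure.restrict_apply hm.compl, ← setLIntegral_const,
    setLIntegral_congr_fun hm hon, setLIntegral_congr_fun hm.compl hoff]

theorem convex_cube (n : ℕ) : Convex ℝ (cube n) := by
  intro x hx y hy s t hs ht hst i
  simpa using convex_Icc (-1 : ℝ) 1 (hx i) (hy i) hs ht hst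

theorem isLipschitzPath_cube_iff :
    IsLipschitzPath (cube n) x y γ ↔ ∃ K : ℝ≥0, IsPath K x y γ :=
  ⟨fun ⟨⟨K, hK⟩, hmaps, h0, h1⟩ ↦ ⟨K, hK, hmaps, h0, h1⟩,
    fun ⟨K, hK, hmaps, h0, h1⟩ ↦ ⟨⟨K, hK⟩, hmaps, h0, h1⟩⟩

theorem IsNetwork.urbanDist_eq_weightedDist (hS : IsNetwork S a b) :
    urbanDist S a b = weightedDist (cube n) (friction S a b) := by
  ext x y
  simp only [urbanDist, weightedDist, isLipschitzPath_cube_iff, hS.imageCost_eq]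

end Network

end UrbanMetric

end

theorem mainTheorem7_general {E : Type*} [NormedAddCommGroup E] [NormedSpace ℝ E]
    [FiniteDimensional ℝ E] [MeasurableSpace E] [BorelSpace E] {Q : Set E} (hQ : Convex ℝ Q)
    {F : E → ℝ≥0∞} (hF : Measurable F) {a : ℝ≥0∞} (hFa : ∀ z, F z ≤ a)
    (hfin : ∀ lam < a, μH[1] {z | F z ≤ lam} ≠ ∞) {xs ys : ℕ → E} {x y : E}
    (hbdd : ∃ M : ℝ≥0, ∀ j, UrbanMetric.weightedDist Q F (xs j) (ys j) ≤ M)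
    {γs : ℕ → ℝ → E} {γ : ℝ → E}
    (hγs : ∀ j, UrbanMetric.IsLipschitzPath Q (xs j) (ys j) (γs j))
    (hγ : UrbanMetric.IsLipschitzPath Q x y γ)
    (hopt : ∀ j, UrbanMetric.weightedLength F (γs j) =
      UrbanMetric.weightedDist Q F (xs j) (ys j))
    (hlim : TendstoUniformlyOn γs γ atTop (Icc 0 1)) :
    UrbanMetric.weightedLength F γ = UrbanMetric.weightedDist Q F x y := by
  obtain ⟨M, hM⟩ := hbdd
  choose Ks σs hσs hγσs using fun j ↦ (hγs j).exists_lipschitzWith_eqOn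
  obtain ⟨K, σ, hσ, hγσ⟩ := hγ.exists_lipschitzWith_eqOn
  have h0 : (0 : ℝ) ∈ Icc 0 1 := left_mem_Icc.2 zero_le_one
  have h1 : (1 : ℝ) ∈ Icc 0 1 := right_mem_Icc.2 zero_le_one
  have hσsQ (j : ℕ) : MapsTo (σs j) (Icc 0 1) Q := (hγs j).mapsTo.congr (hγσs j)
  have hσQ : MapsTo σ (Icc 0 1) Q := hγ.mapsTo.congr hγσ
  have hlimσ : TendstoUniformlyOn σs σ atTop (Icc 0 1) :=
    (hlim.congr (Eventually.of_forall hγσs)).congr_right hγσ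
  have hoptσ (j : ℕ) : UrbanMetric.costMeasure F (σs j) (Ioc 0 1) =
      UrbanMetric.weightedDist Q F (σs j 0) (σs j 1) := by
    rw [← UrbanMetric.weightedLength_eq_costMeasure (hγσs j), hopt, ← hγσs j h0, ← hγσs j h1,
      (hγs j).source, (hγs j).target]
  have hMσ (j : ℕ) : UrbanMetric.costMeasure F (σs j) (Ioc 0 1) ≤ M := by
    rw [← UrbanMetric.weightedLength_eq_costMeasure (hγσs j), hopt]
    exact hM j
  rw [UrbanMetric.weightedLength_eq_costMeasure hγσ, ← hγ.source, ← hγ.target, hγσ h0, hγσ h1]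
  refine le_antisymm (UrbanMetric.costMeasure_le_weightedDist_of_tendstoUniformlyOn hQ hF hFa hfin
    hσs hσ hσsQ hσQ hlimσ hMσ fun j ↦ (hoptσ j).le) ?_
  rw [← uIoc_of_le zero_le_one]
  exact UrbanMetric.weightedDist_le_costMeasure_uIoc hF hσ (by rwa [uIcc_of_le zero_le_one])

theorem mainTheorem7 (n : ℕ) (S : Set (EuclideanSpace ℝ (Fin n))) (a : ℝ≥0∞)
    (b : EuclideanSpace ℝ (Fin n) → ℝ≥0∞) (hS : UrbanMetric.IsNetwork S a b)
    (xs ys : ℕ → EuclideanSpace ℝ (Fin n)) (x y : EuclideanSpace ℝ (Fin n))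
    (hbdd : ∃ M : ℝ≥0, ∀ j, UrbanMetric.urbanDist S a b (xs j) (ys j) ≤ M)
    (C : ℝ≥0) (γs : ℕ → ℝ → EuclideanSpace ℝ (Fin n)) (γ : ℝ → EuclideanSpace ℝ (Fin n))
    (hγs : ∀ j, UrbanMetric.IsPath C (xs j) (ys j) (γs j))
    (hopt : ∀ j, UrbanMetric.length S a b (γs j) = UrbanMetric.urbanDist S a b (xs j) (ys j))
    (hspeed : ∀ j, UrbanMetric.ConstantSpeed (γs j))
    (hγ : UrbanMetric.IsPath C x y γ)
    (hlim : TendstoUniformlyOn γs γ atTop (Icc 0 1)) :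
    UrbanMetric.length S a b γ = UrbanMetric.urbanDist S a b x y := by
  rw [hS.urbanDist_eq_weightedDist] at hbdd hopt ⊢
  exact mainTheorem7_general (UrbanMetric.convex_cube n) hS.measurable_friction hS.friction_le
    (fun _ ↦ hS.hausdorffMeasure_friction_le_ne_top) hbdd
    (fun j ↦ UrbanMetric.isLipschitzPath_cube_iff.2 ⟨C, hγs j⟩)
    (UrbanMetric.isLipschitzPath_cube_iff.2 ⟨C, hγ⟩) hopt hlim
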